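/- Proposition 1.5. Let $L \ge 2$ be an integer, let $\kappa = (\kappa_1,\dots,\kappa_L)$ be a vector of positive integers, put $N = \kappa_1 + \dots + \kappa_L$, and let $x_1,\dots,x_L$ be distinct real numbers. The multislice is $$\Omega_\kappa = \Big\{\omega \in \{x_1,\dots,x_L\}^N : \sum_{i=1}^N \mathbf{1}_{\{\omega_i = x_\ell\}} = \kappa_\ell \text{ for } \ell = 1,\dots,L\Big\},$$ $P_\kappa$ denotes the uniform distribution on $\Omega_\kappa$, and $E_\kappa$ denotes expectation with respect to $P_\kappa$. For $\omega \in \mathbb{R}^N$ and $A \subseteq \mathbb{R}^N$ the convex distance is $$d_T(\omega, A) = \sup_{\alpha \in \mathbb{R}^N,\ |\alpha| = 1}\ \inf_{\omega' \in A}\ \sum_{i=1}^N |\alpha_i|\, \mathbf{1}_{\{\omega_i \ne \omega_i'\}},$$ where $|\alpha|$ is the Euclidean norm. Then for every $A \subseteq \Omega_\kappa$, $$P_\kappa(A)\; E_\kappa \exp\Big(\frac{d_T(\cdot, A)^2}{144}\Big) \le 1,$$ where the left-hand side is read as $0$ if $A = \emptyset$. -/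

import Mathlib

open MeasureTheory ProbabilityTheory

noncomputable section

namespace Multislice

/-- The multislice `Ω_κ`: all vectors of length `N = κ_1 + ⋯ + κ_L` with entries in
`{x_1, …, x_L}` in which each value `x_ℓ` occurs exactly `κ_ℓ` times. -/
def multislice {L : ℕ} (κ : Fin L → ℕ) (x : Fin L → ℝ) : Set (Fin (∑ ℓ, κ ℓ) → ℝ) :=
  {ω | (∀ i, ω i ∈ Set.range x) ∧ ∀ ℓ, (∑ i, if ω i = x ℓ then 1 else 0) = κ ℓ}

/-- The uniform distribution `P_κ` on the (finite) multislice, as a measure on `ℝ^N`. -/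
def uniformMultislice {L : ℕ} (κ : Fin L → ℕ) (x : Fin L → ℝ) :
    Measure (Fin (∑ ℓ, κ ℓ) → ℝ) :=
  uniformOn (multislice κ x)

open Classical in
/-- The weighted Hamming distance `d_α(ω, ω') = ∑ i, |α_i| 1_{ω_i ≠ ω'_i}`. -/
def weightedDist {N : ℕ} {S : Type*} (α : EuclideanSpace ℝ (Fin N)) (ω ω' : Fin N → S) : ℝ :=
  ∑ i, |α i| * (if ω i ≠ ω' i then 1 else 0)

/-- `d_α(ω, A) = inf_{ω' ∈ A} d_α(ω, ω')` (for empty `A` this real infimum is `0`). -/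
def weightedDistTo {N : ℕ} {S : Type*} (α : EuclideanSpace ℝ (Fin N)) (ω : Fin N → S)
    (A : Set (Fin N → S)) : ℝ :=
  ⨅ ω' : A, weightedDist α ω ω'

/-- Talagrand's convex distance `d_T(ω, A)`, the supremum of `d_α(ω, A)` over all `α ∈ ℝ^N`
of Euclidean norm one. -/
def convexDist {N : ℕ} {S : Type*} (ω : Fin N → S) (A : Set (Fin N → S)) : ℝ :=
  ⨆ α : Metric.sphere (0 : EuclideanSpace ℝ (Fin N)) 1, weightedDistTo α ω A

end Multislice

end

open MeasureTheory ProbabilityTheory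

noncomputable section

namespace Multislice

open Finset Equiv

/-! Fix `y ∈ A`. Permuting the coordinates of `y` carries the uniform law on permutations to `P_κ`,
so it suffices to study g(σ) = d_T(y ∘ σ, A)² on the symmetric group. Three ingredients combine.

A modified log-Sobolev inequality for random transpositions (`entSum_le_dirichlet`) bounds entropy
by a sum over transpositions. The function g is weakly self-bounding: one transposition lowers it by
at most 2, and the squared decreases sum to at most 16 N g (`sq_convexDist_sub_le`,
`sum_sq_convexDist_sub_le`). Together they give Ent(exp(tg)) ≤ 32 t² E[g exp(tg)] for |t| ≤ 1/2.

With Λ(t) = log E exp(tg), this says that Λ(t)/t - 32 Λ(t) is nonincreasing, also across t = 0.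
Comparing t = 1/144 with t = -1/80 gives E exp(g/144) · E exp(-g/80) ≤ 1. Since g vanishes on A, the
second factor is at least P(A). -/

/-- The symmetrised relative-entropy density `(a - b) (log a - log b)`. -/
def logDiff (a b : ℝ) : ℝ := (a - b) * (Real.log a - Real.log b)

/-- The unnormalised entropy of a positive function with respect to counting measure. -/
def entSum {ι : Type*} [Fintype ι] (f : ι → ℝ) : ℝ :=
  ∑ i, f i * Real.log (f i) - (∑ i, f i) * Real.log ((∑ i, f i) / Fintype.card ι)

/-- The Dirichlet form of the random transposition walk, evaluated at `(f, log f)`. -/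
def dirichlet {n : ℕ} (f : Perm (Fin n) → ℝ) : ℝ :=
  ∑ i, ∑ j, ∑ σ, logDiff (f σ) (f (σ * swap i j))

/-! ### Log-sum inequality and entropy on finite sets -/

/-- Apply log z ≤ z - 1 at z = b_i A / (a_i B), with A and B the two sums; the corrections a_i - b_i
A / B add up to zero. -/
theorem log_sum_inequality {ι : Type*} (s : Finset ι) (a b : ι → ℝ) (ha : ∀ i, 0 < a i)
    (hb : ∀ i, 0 < b i) :
    (∑ i ∈ s, a i) * (Real.log (∑ i ∈ s, a i) - Real.log (∑ i ∈ s, b i)) ≤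
      ∑ i ∈ s, a i * (Real.log (a i) - Real.log (b i)) := by
  rcases s.eq_empty_or_nonempty with rfl | hs
  · simp
  have hA : 0 < ∑ i ∈ s, a i := sum_pos (fun i _ => ha i) hs
  have hB : 0 < ∑ i ∈ s, b i := sum_pos (fun i _ => hb i) hs
  set A := ∑ i ∈ s, a i
  set B := ∑ i ∈ s, b i
  have key : ∀ i ∈ s, a i * (Real.log A - Real.log B) + (a i - b i * (A / B)) ≤
      a i * (Real.log (a i) - Real.log (b i)) := by
    intro i _
    have h := Real.log_le_sub_one_of_pos (x := (b i * A) / (a i * B))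
      (div_pos (mul_pos (hb i) hA) (mul_pos (ha i) hB))
    rw [Real.log_div (mul_pos (hb i) hA).ne' (mul_pos (ha i) hB).ne',
      Real.log_mul (hb i).ne' hA.ne', Real.log_mul (ha i).ne' hB.ne'] at h
    have h2 := mul_le_mul_of_nonneg_left h (ha i).le
    have h3 : a i * (b i * A / (a i * B) - 1) = b i * (A / B) - a i := by
      have := (ha i).ne'
      field_simp
    rw [h3] at h2
    linarith
  have := sum_le_sum key
  rw [sum_add_distrib, ← sum_mul, sum_sub_distrib, ← sum_mul] at this
  have h4 : B * (A / B) = A := by field_simp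
  change A * _ + (A - B * _) ≤ _ at this
  linarith

theorem logDiff_nonneg {a b : ℝ} (ha : 0 < a) (hb : 0 < b) : 0 ≤ logDiff a b := by
  unfold logDiff
  rcases le_total a b with h | h
  · exact mul_nonneg_of_nonpos_of_nonpos (by linarith) (by linarith [Real.log_le_log ha h])
  · exact mul_nonneg (by linarith) (by linarith [Real.log_le_log hb h])

theorem logDiff_comm (a b : ℝ) : logDiff a b = logDiff b a := by unfold logDiff; ring

theorem logDiff_self (a : ℝ) : logDiff a a = 0 := by simp [logDiff]

theorem logDiff_sum_le {ι : Type*} (s : Finset ι) (a b : ι → ℝ) (ha : ∀ i, 0 < a i)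
    (hb : ∀ i, 0 < b i) :
    logDiff (∑ i ∈ s, a i) (∑ i ∈ s, b i) ≤ ∑ i ∈ s, logDiff (a i) (b i) := by
  have h1 := log_sum_inequality s a b ha hb
  have h2 := log_sum_inequality s b a hb ha
  have h3 := add_le_add h1 h2
  rw [← sum_add_distrib] at h3
  calc _ ≤ _ := le_of_eq (by unfold logDiff; ring)
    _ ≤ _ := h3
    _ = _ := sum_congr rfl fun i _ => by unfold logDiff; ring

theorem entSum_comp_equiv {ι κ : Type*} [Fintype ι] [Fintype κ] (e : ι ≃ κ) (f : κ → ℝ) :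
    entSum (fun i => f (e i)) = entSum f := by
  unfold entSum
  rw [Equiv.sum_comp e f, Equiv.sum_comp e (fun i => f i * Real.log (f i)), Fintype.card_congr e]

/-- Expanding the double sum, the gap between the two sides is twice the total mass times the AM-GM
deficit n log(mean) - ∑ log f_i. -/
theorem two_card_mul_entSum_le {ι : Type*} [Fintype ι] [Nonempty ι] (f : ι → ℝ)
    (hf : ∀ i, 0 < f i) :
    2 * Fintype.card ι * entSum f ≤ ∑ i, ∑ j, logDiff (f i) (f j) := by
  have hN : (0 : ℝ) < Fintype.card ι := by exact_mod_cast Fintype.card_pos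
  have h := log_sum_inequality univ (fun _ : ι => (∑ i, f i) / Fintype.card ι) f
    (fun _ => div_pos (sum_pos (fun i _ => hf i) univ_nonempty) hN) hf
  have hc : ∑ _i : ι, (∑ i, f i) / Fintype.card ι = ∑ i, f i := by
    simp only [sum_const, card_univ, nsmul_eq_mul]
    field_simp
  rw [hc, sub_self, mul_zero, ← mul_sum, sum_sub_distrib] at h
  have hS : 0 < ∑ i, f i := sum_pos (fun i _ => hf i) univ_nonempty
  have h' : 0 ≤ Fintype.card ι * Real.log ((∑ i, f i) / Fintype.card ι) -
      ∑ i, Real.log (f i) := by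
    have := nonneg_of_mul_nonneg_right h (div_pos hS hN)
    simpa using this
  have hexp : ∑ i, ∑ j, logDiff (f i) (f j) =
      2 * Fintype.card ι * ∑ i, f i * Real.log (f i) -
        2 * (∑ i, f i) * ∑ i, Real.log (f i) := by
    have : ∀ i j, logDiff (f i) (f j) = f i * Real.log (f i) + f j * Real.log (f j)
        - f i * Real.log (f j) - f j * Real.log (f i) := fun i j => by unfold logDiff; ring
    simp only [this, sum_sub_distrib, sum_add_distrib, sum_const, card_univ, nsmul_eq_mul,
      ← mul_sum, ← sum_mul]
    ring
  rw [hexp, entSum]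
  nlinarith [mul_nonneg hS.le h']

/-- Chain rule for entropy, the engine of the induction on n. -/
theorem entSum_prod {ι κ : Type*} [Fintype ι] [Fintype κ] [Nonempty ι] [Nonempty κ]
    (f : ι × κ → ℝ) (hf : ∀ p, 0 < f p) :
    entSum f = ∑ i, entSum (fun k => f (i, k)) + entSum (fun i => ∑ k, f (i, k)) := by
  have hι : (0 : ℝ) < Fintype.card ι := by exact_mod_cast Fintype.card_pos
  have hκ : (0 : ℝ) < Fintype.card κ := by exact_mod_cast Fintype.card_pos
  have hS : ∀ i, 0 < ∑ k, f (i, k) := fun i => sum_pos (fun k _ => hf _) univ_nonempty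
  have hT : 0 < ∑ i, ∑ k, f (i, k) := sum_pos (fun k _ => hS _) univ_nonempty
  unfold entSum
  simp only [Fintype.sum_prod_type, Fintype.card_prod, Nat.cast_mul, sum_sub_distrib]
  rw [Real.log_div hT.ne' (mul_pos hι hκ).ne', Real.log_div hT.ne' hι.ne',
    Real.log_mul hι.ne' hκ.ne']
  have : ∀ i, (∑ k, f (i, k)) * Real.log ((∑ k, f (i, k)) / Fintype.card κ) =
      (∑ k, f (i, k)) * Real.log (∑ k, f (i, k)) - (∑ k, f (i, k)) * Real.log (Fintype.card κ) :=
    fun i => by rw [Real.log_div (hS i).ne' hκ.ne']; ring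
  simp only [this, sum_sub_distrib, ← sum_mul]
  ring

/-! ### Modified log-Sobolev inequality for random transpositions -/

theorem decomposeFin_symm_mul_swap {n : ℕ} (p : Fin (n + 1)) (e : Perm (Fin n)) (i j : Fin n) :
    Perm.decomposeFin.symm (p, e * swap i j) =
      Perm.decomposeFin.symm (p, e) * swap i.succ j.succ := by
  ext k
  refine Fin.cases ?_ (fun k => ?_) k
  · simp [Equiv.swap_apply_of_ne_of_ne (Fin.succ_ne_zero i).symm (Fin.succ_ne_zero j).symm]
  · have : swap i.succ j.succ k.succ = (swap i j k).succ := by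
      simp only [Equiv.swap_apply_def, Fin.succ_inj]
      split_ifs <;> rfl
    simp [this]

theorem sum_decomposeFin_symm {n : ℕ} (f : Perm (Fin (n + 1)) → ℝ) (p : Fin (n + 1)) :
    ∑ e, f (Perm.decomposeFin.symm (p, e)) = ∑ σ with σ 0 = p, f σ := by
  rw [sum_filter, ← Equiv.sum_comp Perm.decomposeFin.symm, Fintype.sum_prod_type]
  simp only [Perm.decomposeFin_symm_apply_zero]
  rw [Finset.sum_eq_single p]
  · simp
  · intro b _ hb
    simp [hb]
  · simp

theorem sum_fiber_zero {n : ℕ} (f : Perm (Fin (n + 1)) → ℝ) (p q : Fin (n + 1)) :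
    ∑ σ with σ 0 = q, f σ = ∑ σ with σ 0 = p, f (swap p q * σ) := by
  rw [sum_filter, sum_filter, ← Equiv.sum_comp (Equiv.mulLeft (swap p q))]
  refine sum_congr rfl fun σ _ => ?_
  have : swap p q (σ 0) = q ↔ σ 0 = p := by
    rw [Equiv.swap_apply_eq_iff, Equiv.swap_apply_right]
  simp [this]

/-- Left multiplication by `swap p q` matches the fibres σ 0 = p and σ 0 = q, so the log-sum
inequality lifts the complete-graph bound from the marginal to permutations. On the fibre σ 0 = p
this left factor equals a right transposition of 0 with σ⁻¹ q. -/
theorem entSum_le_of_fiber_zero {n : ℕ} (f : Perm (Fin (n + 1)) → ℝ) (hf : ∀ σ, 0 < f σ) :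
    2 * ((n : ℝ) + 1) * entSum (fun p => ∑ e, f (Perm.decomposeFin.symm (p, e))) ≤
      ∑ j, ∑ σ, logDiff (f σ) (f (σ * swap 0 j)) := by
  have h := two_card_mul_entSum_le (fun p => ∑ e, f (Perm.decomposeFin.symm (p, e)))
    (fun p => sum_pos (fun e _ => hf _) univ_nonempty)
  rw [Fintype.card_fin, Nat.cast_succ] at h
  refine h.trans ?_
  simp only [sum_decomposeFin_symm]
  calc ∑ p, ∑ q, logDiff (∑ σ with σ 0 = p, f σ) (∑ σ with σ 0 = q, f σ)
      ≤ ∑ p : Fin (n + 1), ∑ q, ∑ σ with σ 0 = p, logDiff (f σ) (f (swap p q * σ)) := by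
        refine sum_le_sum fun p _ => sum_le_sum fun q _ => ?_
        rw [sum_fiber_zero f p q]
        exact logDiff_sum_le _ _ _ hf fun σ => hf _
    _ = ∑ p : Fin (n + 1), ∑ σ with σ 0 = p, ∑ q, logDiff (f σ) (f (swap (σ 0) q * σ)) := by
        refine sum_congr rfl fun p _ => ?_
        rw [sum_comm]
        refine sum_congr rfl fun σ hσ => ?_
        rw [(mem_filter.1 hσ).2]
    _ = ∑ σ : Perm (Fin (n + 1)), ∑ q, logDiff (f σ) (f (swap (σ 0) q * σ)) := by
        rw [Finset.sum_fiberwise]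
    _ = ∑ σ : Perm (Fin (n + 1)), ∑ j, logDiff (f σ) (f (σ * swap 0 j)) := by
        refine sum_congr rfl fun σ _ => ?_
        rw [← Equiv.sum_comp σ]
        refine sum_congr rfl fun j _ => ?_
        rw [Equiv.mul_swap_eq_swap_mul]
    _ = _ := sum_comm

/-- Condition on σ 0: the fibres use the induction hypothesis, the marginal uses the transpositions
moving 0. The latter occur twice in `dirichlet` (as (0, j) and (j, 0)) but are needed once, so one
copy is saved. -/
theorem entSum_le_dirichlet_sub {n : ℕ}
    (ih : ∀ f : Perm (Fin n) → ℝ, (∀ σ, 0 < f σ) → 2 * ((n : ℝ) + 1) * entSum f ≤ dirichlet f)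
    (f : Perm (Fin (n + 1)) → ℝ) (hf : ∀ σ, 0 < f σ) :
    2 * ((n : ℝ) + 1) * entSum f ≤
      dirichlet f - ∑ j, ∑ σ, logDiff (f σ) (f (σ * swap 0 j)) := by
  have h1 := entSum_le_of_fiber_zero f hf
  rw [← entSum_comp_equiv Perm.decomposeFin.symm f, entSum_prod _ (fun _ => hf _), mul_add]
  have h2 : 2 * ((n : ℝ) + 1) * ∑ p, entSum (fun e => f (Perm.decomposeFin.symm (p, e))) ≤
      ∑ i : Fin n, ∑ j : Fin n, ∑ σ, logDiff (f σ) (f (σ * swap i.succ j.succ)) := by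
    rw [mul_sum]
    refine (sum_le_sum fun p _ => ih _ fun e => hf _).trans (le_of_eq ?_)
    unfold dirichlet
    rw [sum_comm]
    refine sum_congr rfl fun i _ => ?_
    rw [sum_comm]
    refine sum_congr rfl fun j _ => ?_
    rw [← Equiv.sum_comp Perm.decomposeFin.symm, Fintype.sum_prod_type]
    simp only [decomposeFin_symm_mul_swap]
  have h3 : dirichlet f = 2 * ∑ j, ∑ σ, logDiff (f σ) (f (σ * swap 0 j)) +
      ∑ i : Fin n, ∑ j : Fin n, ∑ σ, logDiff (f σ) (f (σ * swap i.succ j.succ)) := by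
    unfold dirichlet
    simp only [Fin.sum_univ_succ, sum_add_distrib, swap_self, ← Perm.one_def, mul_one,
      logDiff_self, sum_const_zero, zero_add, swap_comm _ (0 : Fin (n + 1))]
    ring
  linarith

theorem sum_logDiff_comp_mulRight {n : ℕ} (f : Perm (Fin n) → ℝ) (τ : Perm (Fin n)) (i : Fin n) :
    ∑ j, ∑ σ, logDiff (f (σ * τ)) (f (σ * swap i j * τ)) =
      ∑ j, ∑ σ, logDiff (f σ) (f (σ * swap (τ⁻¹ i) j)) := by
  rw [← Equiv.sum_comp τ⁻¹ (fun j => ∑ σ, logDiff (f σ) (f (σ * swap (τ⁻¹ i) j)))]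
  refine sum_congr rfl fun j _ => ?_
  rw [← Equiv.sum_comp (Equiv.mulRight τ)
    (fun σ => logDiff (f σ) (f (σ * swap (τ⁻¹ i) (τ⁻¹ j))))]
  refine sum_congr rfl fun σ _ => ?_
  rw [mul_assoc σ, Equiv.swap_mul_eq_mul_swap, Equiv.coe_mulRight, mul_assoc]

theorem dirichlet_comp_mulRight {n : ℕ} (f : Perm (Fin n) → ℝ) (τ : Perm (Fin n)) :
    dirichlet (fun σ => f (σ * τ)) = dirichlet f := by
  unfold dirichlet
  rw [← Equiv.sum_comp τ⁻¹ (fun i => ∑ j, ∑ σ, logDiff (f σ) (f (σ * swap i j)))]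
  exact sum_congr rfl fun i _ => sum_logDiff_comp_mulRight f τ i

/-- A modified logarithmic Sobolev inequality for the random transposition walk. -/
theorem entSum_le_dirichlet (n : ℕ) (f : Perm (Fin n) → ℝ) (hf : ∀ σ, 0 < f σ) :
    2 * ((n : ℝ) + 1) * entSum f ≤ dirichlet f := by
  induction n with
  | zero => simp [entSum, dirichlet]
  | succ n ih =>
    -- Right translation by `swap 0 l` lets any l play the role of 0; summed over l, the saved
    -- copies make up one full Dirichlet form.
    have hl : ∀ l : Fin (n + 1), 2 * ((n : ℝ) + 1) * entSum f ≤
        dirichlet f - ∑ j, ∑ σ, logDiff (f σ) (f (σ * swap l j)) := by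
      intro l
      have h := entSum_le_dirichlet_sub ih (fun σ => f (σ * swap 0 l)) (fun σ => hf _)
      have he : entSum (fun σ => f (σ * swap 0 l)) = entSum f :=
        entSum_comp_equiv (Equiv.mulRight (swap 0 l)) f
      rwa [dirichlet_comp_mulRight, he, sum_logDiff_comp_mulRight, swap_inv,
        Equiv.swap_apply_left] at h
    have hsum := sum_le_sum fun l (_ : l ∈ (univ : Finset (Fin (n + 1)))) => hl l
    simp only [sum_const, card_univ, Fintype.card_fin, nsmul_eq_mul, sum_sub_distrib] at hsum
    change _ ≤ _ - dirichlet f at hsum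
    have hE : 0 ≤ dirichlet f := sum_nonneg fun i _ => sum_nonneg fun j _ =>
      sum_nonneg fun σ _ => logDiff_nonneg (hf _) (hf _)
    push_cast at hsum ⊢
    have hn : (0 : ℝ) ≤ n := n.cast_nonneg
    -- The sum reads 2(n+1)² Ent ≤ n D; multiply by n + 2 and use n(n+2) ≤ (n+1)².
    have h2 : ((n : ℝ) + 1) ^ 2 * (2 * ((n : ℝ) + 1 + 1) * entSum f) ≤
        ((n : ℝ) + 1) ^ 2 * dirichlet f := by
      nlinarith [mul_le_mul_of_nonneg_left hsum (by linarith : (0 : ℝ) ≤ n + 2)]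
    exact le_of_mul_le_mul_left h2 (by positivity)

/-! ### Entropy of exponentials and the Herbst argument -/

/-- The exponents differ by at most 1, where |exp w - 1| ≤ 2|w|. -/
theorem logDiff_exp_le_of_le {t a b : ℝ} (ht : |t| ≤ 1 / 2) (hba : b ≤ a) (hab : a - b ≤ 2) :
    logDiff (Real.exp (t * a)) (Real.exp (t * b)) ≤
      2 * t ^ 2 * (a - b) ^ 2 * Real.exp (t * a) := by
  have hw : |(-(t * (a - b)))| ≤ 1 := by
    rw [abs_neg, abs_mul, abs_of_nonneg (sub_nonneg.2 hba)]
    nlinarith [abs_nonneg t]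
  have h := Real.abs_exp_sub_one_le hw
  have he : Real.exp (t * b) = Real.exp (t * a) * Real.exp (-(t * (a - b))) := by
    rw [← Real.exp_add]; ring_nf
  have h1 : logDiff (Real.exp (t * a)) (Real.exp (t * b)) =
      Real.exp (t * a) * ((-(t * (a - b))) * (Real.exp (-(t * (a - b))) - 1)) := by
    unfold logDiff
    rw [Real.log_exp, Real.log_exp, he]
    ring
  rw [h1]
  have h2 : (-(t * (a - b))) * (Real.exp (-(t * (a - b))) - 1) ≤ 2 * (t * (a - b)) ^ 2 := by
    refine (le_abs_self _).trans ?_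
    rw [abs_mul]
    refine (mul_le_mul_of_nonneg_left h (abs_nonneg _)).trans (le_of_eq ?_)
    rw [abs_neg, ← sq_abs (t * (a - b))]
    ring
  have := mul_le_mul_of_nonneg_left h2 (Real.exp_pos (t * a)).le
  linarith

theorem logDiff_exp_le {t a b : ℝ} (ht : |t| ≤ 1 / 2) (hab : a - b ≤ 2) (hba : b - a ≤ 2) :
    logDiff (Real.exp (t * a)) (Real.exp (t * b)) ≤
      2 * t ^ 2 * (max (a - b) 0) ^ 2 * Real.exp (t * a) +
        2 * t ^ 2 * (max (b - a) 0) ^ 2 * Real.exp (t * b) := by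
  rcases le_total b a with h | h
  · rw [max_eq_left (by linarith : 0 ≤ a - b)]
    exact (logDiff_exp_le_of_le ht h hab).trans (le_add_of_nonneg_right (by positivity))
  · rw [max_eq_left (by linarith : 0 ≤ b - a), logDiff_comm]
    exact (logDiff_exp_le_of_le ht h hba).trans (le_add_of_nonneg_left (by positivity))

/-- Entropy bound for exponentials of a weakly self-bounding function on the symmetric group. -/
theorem entSum_exp_le {n : ℕ} (g : Perm (Fin n) → ℝ) (h0 : ∀ σ, 0 ≤ g σ)
    (h2 : ∀ σ i j, g σ - g (σ * swap i j) ≤ 2)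
    (hsb : ∀ σ, ∑ i, ∑ j, (max (g σ - g (σ * swap i j)) 0) ^ 2 ≤ 16 * n * g σ)
    {t : ℝ} (ht : |t| ≤ 1 / 2) :
    entSum (fun σ => Real.exp (t * g σ)) ≤ 32 * t ^ 2 * ∑ σ, g σ * Real.exp (t * g σ) := by
  have hD := entSum_le_dirichlet n (fun σ => Real.exp (t * g σ)) (fun σ => Real.exp_pos _)
  have h2' : ∀ σ i j, g (σ * swap i j) - g σ ≤ 2 := fun σ i j => by
    have := h2 (σ * swap i j) i j
    rwa [mul_assoc, swap_mul_self, mul_one] at this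
  have hij : ∀ i j, ∑ σ, logDiff (Real.exp (t * g σ)) (Real.exp (t * g (σ * swap i j))) ≤
      ∑ σ, 4 * t ^ 2 * Real.exp (t * g σ) * (max (g σ - g (σ * swap i j)) 0) ^ 2 := by
    intro i j
    refine (sum_le_sum fun σ _ => logDiff_exp_le ht (h2 σ i j) (h2' σ i j)).trans (le_of_eq ?_)
    -- The involution σ ↦ σ * swap i j turns the second half into the first, whence 4 t².
    rw [sum_add_distrib, ← Equiv.sum_comp (Equiv.mulRight (swap i j))
      (fun σ => 2 * t ^ 2 * (max (g (σ * swap i j) - g σ) 0) ^ 2 *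
        Real.exp (t * g (σ * swap i j)))]
    simp only [Equiv.coe_mulRight, mul_assoc _ (swap i j) (swap i j), swap_mul_self, mul_one]
    rw [← sum_add_distrib]
    exact sum_congr rfl fun σ _ => by ring
  have hE : dirichlet (fun σ => Real.exp (t * g σ)) ≤
      64 * n * t ^ 2 * ∑ σ, g σ * Real.exp (t * g σ) := by
    refine (sum_le_sum fun i _ => sum_le_sum fun j _ => hij i j).trans ?_
    rw [sum_congr rfl fun i _ => sum_comm, sum_comm, mul_sum]
    refine sum_le_sum fun σ _ => ?_
    simp only [← mul_sum]
    refine (mul_le_mul_of_nonneg_left (hsb σ) (by positivity)).trans (le_of_eq ?_)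
    ring
  have hZ : 0 ≤ ∑ σ, g σ * Real.exp (t * g σ) :=
    sum_nonneg fun σ _ => mul_nonneg (h0 σ) (Real.exp_pos _).le
  have hn : (0 : ℝ) ≤ n := n.cast_nonneg
  have hp : (0 : ℝ) < 2 * (n + 1) := by linarith
  refine le_of_mul_le_mul_left ((hD.trans hE).trans ?_) hp
  nlinarith [mul_nonneg (sq_nonneg t) hZ]

/-- The Herbst argument, comparing both sides of the origin. -/
theorem herbst_two_sided (Λ Λ' : ℝ → ℝ) (hd : ∀ t, HasDerivAt Λ (Λ' t) t) (h0 : Λ 0 = 0)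
    {c r : ℝ} (h : ∀ t, |t| ≤ r → t * Λ' t - Λ t ≤ c * t ^ 2 * Λ' t)
    {a b : ℝ} (ha : 0 < a) (hb : 0 < b) (har : a ≤ r) (hbr : b ≤ r) :
    Λ b / b - c * Λ b ≤ Λ (-a) / (-a) - c * Λ (-a) := by
  -- `dslope` fills the singularity of Λ(t)/t at 0 continuously; monotonicity on each side is then
  -- glued at 0.
  let u : ℝ → ℝ := fun t => dslope Λ 0 t - c * Λ t
  have hdiff : Differentiable ℝ Λ := fun t => (hd t).differentiableAt
  have hcont : Continuous u := by
    have : Continuous (dslope Λ 0) := by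
      rw [← continuousOn_univ, continuousOn_dslope Filter.univ_mem]
      exact ⟨hdiff.continuous.continuousOn, hdiff 0⟩
    exact this.sub (continuous_const.mul hdiff.continuous)
  have hval : ∀ t, t ≠ 0 → u t = Λ t / t - c * Λ t := fun t ht => by
    simp only [u, dslope_of_ne _ ht, slope_def_field, h0, sub_zero]
  have hderiv : ∀ t, t ≠ 0 → HasDerivAt u ((Λ' t * t - Λ t * 1) / t ^ 2 - c * Λ' t) t := by
    intro t ht
    refine (((hd t).div (hasDerivAt_id t) ht).sub ((hd t).const_mul c)).congr_of_eventuallyEq ?_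
    filter_upwards [eventually_ne_nhds ht] with s hs
    simpa using hval s hs
  have hneg : ∀ t, t ≠ 0 → |t| ≤ r → deriv u t ≤ 0 := by
    intro t ht htr
    rw [(hderiv t ht).deriv]
    have ht2 : 0 < t ^ 2 := by positivity
    rw [sub_nonpos, div_le_iff₀ ht2]
    linarith [h t htr]
  have h1 : AntitoneOn u (Set.Icc (-a) 0) := by
    refine antitoneOn_of_deriv_nonpos (convex_Icc _ _) hcont.continuousOn ?_ ?_ <;>
      rw [interior_Icc]
    · exact fun t ht => (hderiv t ht.2.ne).differentiableAt.differentiableWithinAt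
    · refine fun t ht => hneg t ht.2.ne ?_
      rw [abs_of_neg ht.2]; linarith [ht.1]
  have h2 : AntitoneOn u (Set.Icc 0 b) := by
    refine antitoneOn_of_deriv_nonpos (convex_Icc _ _) hcont.continuousOn ?_ ?_ <;>
      rw [interior_Icc]
    · exact fun t ht => (hderiv t ht.1.ne').differentiableAt.differentiableWithinAt
    · refine fun t ht => hneg t ht.1.ne' ?_
      rw [abs_of_pos ht.1]; linarith [ht.2]
  have e1 : u 0 ≤ u (-a) := h1 ⟨le_rfl, by linarith⟩ ⟨by linarith, le_rfl⟩ (by linarith)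
  have e2 : u b ≤ u 0 := h2 ⟨le_rfl, hb.le⟩ ⟨hb.le, le_rfl⟩ hb.le
  rw [← hval b hb.ne', ← hval (-a) (by linarith)]
  exact e2.trans e1

theorem sum_exp_mul_sum_exp_le {n : ℕ} (g : Perm (Fin n) → ℝ) (h0 : ∀ σ, 0 ≤ g σ)
    (h2 : ∀ σ i j, g σ - g (σ * swap i j) ≤ 2)
    (hsb : ∀ σ, ∑ i, ∑ j, (max (g σ - g (σ * swap i j)) 0) ^ 2 ≤ 16 * n * g σ) :
    (∑ σ, Real.exp (g σ / 144)) * (∑ σ, Real.exp (-(g σ / 80))) ≤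
      (Fintype.card (Perm (Fin n)) : ℝ) ^ 2 := by
  set C : ℝ := ((Fintype.card (Perm (Fin n)) : ℕ) : ℝ) with hCdef
  have hC : 0 < C := Nat.cast_pos.2 Fintype.card_pos
  let Z : ℝ → ℝ := fun t => ∑ σ, Real.exp (t * g σ)
  let Z' : ℝ → ℝ := fun t => ∑ σ, g σ * Real.exp (t * g σ)
  have hZ : ∀ t, 0 < Z t := fun t => sum_pos (fun σ _ => Real.exp_pos _) univ_nonempty
  have hZd : ∀ t, HasDerivAt Z (Z' t) t := by
    intro t
    refine HasDerivAt.fun_sum fun σ _ => ?_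
    have := ((hasDerivAt_id t).mul_const (g σ)).exp
    simpa [mul_comm] using this
  have hΛ : ∀ t, HasDerivAt (fun t => Real.log (Z t) - Real.log C) (Z' t / Z t) t := fun t =>
    ((hZd t).log (hZ t).ne').sub_const _
  have hdiff : ∀ t, |t| ≤ 1 / 2 → t * (Z' t / Z t) - (Real.log (Z t) - Real.log C) ≤
      32 * t ^ 2 * (Z' t / Z t) := by
    intro t ht
    have h := entSum_exp_le g h0 h2 hsb ht
    have he : entSum (fun σ => Real.exp (t * g σ)) =
        t * Z' t - Z t * (Real.log (Z t) - Real.log C) := by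
      unfold entSum
      rw [← hCdef]
      change _ - Z t * Real.log (Z t / C) = _
      rw [Real.log_div (hZ t).ne' hC.ne']
      simp only [Real.log_exp, Z', mul_sum]
      congr 1
      exact sum_congr rfl fun σ _ => by ring
    rw [he] at h
    change _ ≤ 32 * t ^ 2 * Z' t at h
    have hz := hZ t
    refine le_of_mul_le_mul_left (le_trans (le_of_eq ?_) (h.trans (le_of_eq ?_))) hz <;> field_simp
  have hz0 : Real.log (Z 0) - Real.log C = 0 := by
    simp [Z, hCdef]
  -- The rates satisfy 144 - 32 = 80 + 32 = 112, so both values of Λ carry the same weight and it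
  -- cancels.
  have key := herbst_two_sided _ _ hΛ hz0 hdiff (a := 1 / 80) (b := 1 / 144)
    (by norm_num) (by norm_num) (by norm_num) (by norm_num)
  have hsum : Real.log (Z (1 / 144)) + Real.log (Z (-(1 / 80))) ≤ Real.log C + Real.log C := by
    norm_num at key ⊢
    linarith
  rw [← Real.log_mul (hZ _).ne' (hZ _).ne', ← Real.log_mul hC.ne' hC.ne'] at hsum
  have := (Real.log_le_log_iff (mul_pos (hZ _) (hZ _)) (mul_pos hC hC)).1 hsum
  rw [← sq] at this
  refine le_trans (le_of_eq ?_) this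
  congr 1 <;> refine sum_congr rfl fun σ _ => ?_ <;> congr 1 <;> ring

/-! ### Regularity of the convex distance -/

section ConvexDist

variable {N : ℕ} {S : Type*}

theorem weightedDist_nonneg (α : EuclideanSpace ℝ (Fin N)) (ω ω' : Fin N → S) :
    0 ≤ weightedDist α ω ω' :=
  sum_nonneg fun i _ => mul_nonneg (abs_nonneg _) (by split_ifs <;> norm_num)

theorem bddBelow_weightedDist (α : EuclideanSpace ℝ (Fin N)) (ω : Fin N → S)
    (A : Set (Fin N → S)) : BddBelow (Set.range fun ω' : A => weightedDist α ω ω') :=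
  ⟨0, by rintro _ ⟨ω', rfl⟩; exact weightedDist_nonneg _ _ _⟩

theorem weightedDistTo_nonneg (α : EuclideanSpace ℝ (Fin N)) (ω : Fin N → S)
    (A : Set (Fin N → S)) : 0 ≤ weightedDistTo α ω A :=
  Real.iInf_nonneg fun _ => weightedDist_nonneg _ _ _

theorem convexDist_nonneg (ω : Fin N → S) (A : Set (Fin N → S)) : 0 ≤ convexDist ω A :=
  Real.iSup_nonneg fun _ => weightedDistTo_nonneg _ _ _

theorem weightedDistTo_le {A : Set (Fin N → S)} (α : EuclideanSpace ℝ (Fin N)) (ω : Fin N → S)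
    {τ : Fin N → S} (hτ : τ ∈ A) : weightedDistTo α ω A ≤ weightedDist α ω τ :=
  ciInf_le (bddBelow_weightedDist α ω A) (⟨τ, hτ⟩ : A)

theorem weightedDistTo_le_add {A : Set (Fin N → S)} (hA : A.Nonempty)
    {α β : EuclideanSpace ℝ (Fin N)} {ω ω' : Fin N → S} {c : ℝ}
    (h : ∀ τ, weightedDist α ω τ ≤ weightedDist β ω' τ + c) :
    weightedDistTo α ω A ≤ weightedDistTo β ω' A + c := by
  have : Nonempty A := hA.to_subtype
  rw [← sub_le_iff_le_add]
  refine le_ciInf fun τ => ?_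
  rw [sub_le_iff_le_add]
  exact (weightedDistTo_le α ω τ.2).trans (h τ)

theorem convexDist_eq_zero_of_mem {A : Set (Fin N → S)} {ω : Fin N → S} (hω : ω ∈ A) :
    convexDist ω A = 0 := by
  refine le_antisymm (Real.iSup_le (fun α => ?_) le_rfl) (convexDist_nonneg _ _)
  exact (weightedDistTo_le _ ω hω).trans (le_of_eq (by simp [weightedDist]))

theorem continuous_weightedDistTo {A : Set (Fin N → S)} (hA : A.Nonempty) (ω : Fin N → S) :
    Continuous fun α : EuclideanSpace ℝ (Fin N) => weightedDistTo α ω A := by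
  refine (LipschitzWith.of_le_add_mul (N : NNReal) fun α β => ?_).continuous
  refine weightedDistTo_le_add hA fun τ => ?_
  unfold weightedDist
  have : ((N : NNReal) : ℝ) * dist α β = ∑ _i : Fin N, dist α β := by simp
  rw [this, ← sum_add_distrib]
  refine sum_le_sum fun i _ => ?_
  have h1 : |α i| - |β i| ≤ dist α β := by
    refine (abs_sub_abs_le_abs_sub _ _).trans ?_
    rw [dist_eq_norm]
    exact PiLp.norm_apply_le (α - β) i
  split_ifs <;> simp only [mul_one, mul_zero] <;> linarith [dist_nonneg (x := α) (y := β)]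

theorem weightedDistTo_le_convexDist {A : Set (Fin N → S)} (hA : A.Nonempty) (ω : Fin N → S)
    (α : Metric.sphere (0 : EuclideanSpace ℝ (Fin N)) 1) :
    weightedDistTo α ω A ≤ convexDist ω A := by
  refine le_ciSup (f := fun α : Metric.sphere (0 : EuclideanSpace ℝ (Fin N)) 1 =>
    weightedDistTo (α : EuclideanSpace ℝ (Fin N)) ω A) ?_ α
  have := (isCompact_sphere (0 : EuclideanSpace ℝ (Fin N)) 1).bddAbove_image
    (continuous_weightedDistTo hA ω).continuousOn
  rwa [Set.image_eq_range] at this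

theorem exists_convexDist_eq {A : Set (Fin N → S)} (hA : A.Nonempty) (ω : Fin N → S)
    (hN : 0 < N) :
    ∃ α : EuclideanSpace ℝ (Fin N), ‖α‖ = 1 ∧ convexDist ω A = weightedDistTo α ω A := by
  have : Nonempty (Fin N) := ⟨⟨0, hN⟩⟩
  have hne : (Metric.sphere (0 : EuclideanSpace ℝ (Fin N)) 1).Nonempty :=
    NormedSpace.sphere_nonempty.2 zero_le_one
  obtain ⟨α, hα, hmax⟩ := (isCompact_sphere (0 : EuclideanSpace ℝ (Fin N)) 1).exists_isMaxOn hne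
    (continuous_weightedDistTo hA ω).continuousOn
  have := hne.to_subtype
  exact ⟨α, by simpa using hα, le_antisymm (ciSup_le fun β => hmax β.2)
    (weightedDistTo_le_convexDist hA ω ⟨α, hα⟩)⟩

theorem weightedDistTo_smul (A : Set (Fin N → S)) (ω : Fin N → S) {r : ℝ}
    (hr : 0 ≤ r) (β : EuclideanSpace ℝ (Fin N)) :
    weightedDistTo (r • β) ω A = r * weightedDistTo β ω A := by
  unfold weightedDistTo
  rw [Real.mul_iInf_of_nonneg hr]
  congr 1
  funext τ
  simp [weightedDist, mul_sum, abs_mul, abs_of_nonneg hr]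

theorem weightedDistTo_le_norm_mul {A : Set (Fin N → S)} (hA : A.Nonempty) (ω : Fin N → S)
    (β : EuclideanSpace ℝ (Fin N)) : weightedDistTo β ω A ≤ ‖β‖ * convexDist ω A := by
  rcases eq_or_ne β 0 with rfl | hβ
  · obtain ⟨τ, hτ⟩ := hA
    simpa [weightedDist] using weightedDistTo_le 0 ω hτ
  · have hn : 0 < ‖β‖ := norm_pos_iff.2 hβ
    have h1 : β = ‖β‖ • (‖β‖⁻¹ • β) := by rw [smul_smul, mul_inv_cancel₀ hn.ne', one_smul]
    have h2 : ‖β‖⁻¹ • β ∈ Metric.sphere (0 : EuclideanSpace ℝ (Fin N)) 1 := by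
      simp [norm_smul, hn.ne']
    conv_lhs => rw [h1, weightedDistTo_smul A ω hn.le]
    exact mul_le_mul_of_nonneg_left (weightedDistTo_le_convexDist hA ω ⟨_, h2⟩) hn.le

/-- Changing two coordinates changes the convex distance in a controlled way. -/
theorem exists_convexDist_le {A : Set (Fin N → S)} (hA : A.Nonempty) (ω : Fin N → S)
    (hN : 0 < N) : ∃ α : Fin N → ℝ, (∀ i, 0 ≤ α i) ∧ ∑ i, α i ^ 2 = 1 ∧
      ∀ i j, i ≠ j → ∀ ω', (∀ k, k ≠ i → k ≠ j → ω' k = ω k) →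
        α i ^ 2 + α j ^ 2 ≤ 1 ∧
        convexDist ω A ≤ α i + α j + √(1 - α i ^ 2 - α j ^ 2) * convexDist ω' A := by
  obtain ⟨α, hα, hd⟩ := exists_convexDist_eq hA ω hN
  have hsum : ∑ i, |α i| ^ 2 = 1 := by
    have := EuclideanSpace.norm_sq_eq α
    rw [hα] at this
    simpa using this.symm
  refine ⟨fun i => |α i|, fun i => abs_nonneg _, hsum, fun i j hij ω' hω => ?_⟩
  -- With α optimal for ω, deleting coordinates i and j costs at most |α i| + |α j| and leaves a
  -- weight blind to the change from ω to ω'.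
  let β : EuclideanSpace ℝ (Fin N) := WithLp.toLp 2 fun k => if k = i ∨ k = j then 0 else α k
  have hsplit : ∀ f : Fin N → ℝ, ∑ k, f k = f i + f j + ∑ k, if k = i ∨ k = j then 0 else f k := by
    intro f
    have : ∀ k, f k = (if k = i then f i else 0) + (if k = j then f j else 0) +
        (if k = i ∨ k = j then 0 else f k) := by
      intro k
      by_cases h1 : k = i
      · subst h1; simp [hij]
      · by_cases h2 : k = j
        · subst h2; simp [h1]
        · simp [h1, h2]
    calc ∑ k, f k = _ := sum_congr rfl fun k _ => this k
      _ = _ := by simp [sum_add_distrib]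
  have hβ2 : ‖β‖ ^ 2 = 1 - |α i| ^ 2 - |α j| ^ 2 := by
    rw [EuclideanSpace.norm_sq_eq, ← hsum, hsplit fun k => |α k| ^ 2]
    have : ∀ k, ‖β k‖ ^ 2 = if k = i ∨ k = j then 0 else |α k| ^ 2 := fun k => by
      by_cases h : k = i ∨ k = j <;> simp [β, h]
    simp only [this]
    ring
  have hβ : ‖β‖ = √(1 - |α i| ^ 2 - |α j| ^ 2) := by
    rw [← hβ2, Real.sqrt_sq (norm_nonneg _)]
  refine ⟨by nlinarith [sq_nonneg ‖β‖], ?_⟩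
  rw [hd, ← hβ, add_comm]
  refine (weightedDistTo_le_add hA (β := β) (ω' := ω') fun τ => ?_).trans
    (add_le_add_left (weightedDistTo_le_norm_mul hA ω' β) _)
  unfold weightedDist
  rw [hsplit fun k => |α k| * _, add_comm]
  refine add_le_add (sum_le_sum fun k _ => ?_) (add_le_add ?_ ?_)
  · by_cases h : k = i ∨ k = j
    · simp [β, h]
    · have h' := not_or.1 h
      have hk := hω k h'.1 h'.2
      by_cases hτ : ω k = τ k
      · simp [hτ, hk]
      · simp [β, h, hτ, hk]
  · split_ifs <;> simp
  · split_ifs <;> simp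

theorem sq_convexDist_sub_le {A : Set (Fin N → S)} (hA : A.Nonempty) (ω : Fin N → S)
    (i j : Fin N) :
    convexDist ω A ^ 2 - convexDist (ω ∘ swap i j) A ^ 2 ≤ 2 := by
  rcases eq_or_ne i j with rfl | hij
  · simp
  obtain ⟨α, h0, -, h⟩ := exists_convexDist_le hA ω i.pos
  obtain ⟨h1, h2⟩ := h i j hij (ω ∘ swap i j) fun k hi hj => by
    simp [Equiv.swap_apply_of_ne_of_ne hi hj]
  set d := convexDist ω A
  set d' := convexDist (ω ∘ swap i j) A
  have hs := Real.sq_sqrt (show 0 ≤ 1 - α i ^ 2 - α j ^ 2 by linarith)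
  set s := √(1 - α i ^ 2 - α j ^ 2)
  have hd : 0 ≤ d := convexDist_nonneg _ _
  have h3 : d ^ 2 ≤ (α i + α j + s * d') ^ 2 := pow_le_pow_left₀ hd h2 2
  -- Cauchy–Schwarz for the unit vector (α i, α j, s) against (1, 1, d') gives d² ≤ 2 + d'²; the
  -- hints are the squares in Lagrange's identity.
  nlinarith [sq_nonneg (α i - α j), sq_nonneg (α i * d' - s), sq_nonneg (α j * d' - s)]

theorem sum_sq_convexDist_sub_le {A : Set (Fin N → S)} (hA : A.Nonempty) (ω : Fin N → S) :
    ∑ i, ∑ j, (max (convexDist ω A ^ 2 - convexDist (ω ∘ swap i j) A ^ 2) 0) ^ 2 ≤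
      16 * N * convexDist ω A ^ 2 := by
  rcases N.eq_zero_or_pos with rfl | hN
  · simp
  obtain ⟨α, h0, hs, h⟩ := exists_convexDist_le hA ω hN
  -- A decrease satisfies d² - d'² ≤ 2d(α i + α j); square it and use (a + b)² ≤ 2(a² + b²). Summing
  -- over i and j with ∑ α i² = 1 gives 8 · 2N = 16N.
  have hterm : ∀ i j, (max (convexDist ω A ^ 2 - convexDist (ω ∘ swap i j) A ^ 2) 0) ^ 2 ≤
      8 * convexDist ω A ^ 2 * (α i ^ 2 + α j ^ 2) := by
    intro i j
    have hd : 0 ≤ convexDist ω A := convexDist_nonneg _ _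
    have hd' : 0 ≤ convexDist (ω ∘ swap i j) A := convexDist_nonneg _ _
    rcases le_total (convexDist ω A) (convexDist (ω ∘ swap i j) A) with hle | hle
    · rw [max_eq_right (by nlinarith)]
      norm_num
      positivity
    rcases eq_or_ne i j with rfl | hij
    · simp
      positivity
    obtain ⟨h1, h2⟩ := h i j hij (ω ∘ swap i j) fun k hi hj => by
      simp [Equiv.swap_apply_of_ne_of_ne hi hj]
    rw [max_eq_left (by nlinarith)]
    set d := convexDist ω A
    set d' := convexDist (ω ∘ swap i j) A
    have hs1 : √(1 - α i ^ 2 - α j ^ 2) ≤ 1 := Real.sqrt_le_one.2 (by nlinarith)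
    have h3 : d - d' ≤ α i + α j := by nlinarith
    have h4 : d ^ 2 - d' ^ 2 ≤ (α i + α j) * (2 * d) := by
      have : d ^ 2 - d' ^ 2 = (d - d') * (d + d') := by ring
      rw [this]
      exact mul_le_mul h3 (by linarith) (by linarith) (add_nonneg (h0 i) (h0 j))
    have h5 := pow_le_pow_left₀ (by nlinarith) h4 2
    nlinarith [mul_nonneg (sq_nonneg d) (sq_nonneg (α i - α j))]
  refine (sum_le_sum fun i _ => sum_le_sum fun j _ => hterm i j).trans (le_of_eq ?_)
  simp only [← mul_sum, sum_add_distrib, sum_const, card_univ, Fintype.card_fin, nsmul_eq_mul, hs]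
  ring

end ConvexDist

/-! ### From the multislice to permutations -/

theorem integral_uniformOn_finset {Ω : Type*} [MeasurableSpace Ω] [MeasurableSingletonClass Ω]
    (s : Finset Ω) (F : Ω → ℝ) :
    ∫ ω, F ω ∂(uniformOn (s : Set Ω)) = (s.card : ℝ)⁻¹ * ∑ ω ∈ s, F ω := by
  have hint : IntegrableOn F (s : Set Ω) Measure.count := by
    rw [← Set.biUnion_of_singleton (s : Set Ω)]
    exact (integrableOn_finite_biUnion s.finite_toSet).2 fun ω _ =>
      integrableOn_singleton (hx := by simp)
  rw [uniformOn, ProbabilityTheory.cond, integral_smul_measure, setIntegral_finset s hint,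
    Measure.count_apply_finset]
  simp

theorem exists_comp_perm_eq {N : ℕ} {S : Type*} [DecidableEq S] (y ω : Fin N → S)
    (h : ∀ c, #{i | ω i = c} = #{i | y i = c}) : ∃ σ : Perm (Fin N), y ∘ σ = ω := by
  have hc : ∀ c, Nonempty ({i // ω i = c} ≃ {i // y i = c}) := fun c => by
    refine ⟨Fintype.equivOfCardEq ?_⟩
    rw [Fintype.card_subtype, Fintype.card_subtype, h c]
  exact ⟨Equiv.ofFiberEquiv fun c => (hc c).some, funext fun i => Equiv.ofFiberEquiv_map _ i⟩

/-- Double counting over pairs (ω, τ) replaces any computation of stabilisers. -/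
theorem card_mul_sum_orbit {N : ℕ} {S : Type*} (s : Finset (Fin N → S)) (y : Fin N → S)
    (hs : ∀ ω, ω ∈ s ↔ ∃ σ : Perm (Fin N), y ∘ σ = ω) (F : (Fin N → S) → ℝ) :
    (Fintype.card (Perm (Fin N)) : ℝ) * ∑ ω ∈ s, F ω =
      s.card * ∑ σ : Perm (Fin N), F (y ∘ σ) := by
  have h1 : ∀ τ : Perm (Fin N), ∑ ω ∈ s, F (ω ∘ τ) = ∑ ω ∈ s, F ω := by
    intro τ
    refine sum_nbij' (fun ω => ω ∘ τ) (fun ω => ω ∘ τ.symm) ?_ ?_ ?_ ?_ ?_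
    · intro ω hω
      obtain ⟨σ, rfl⟩ := (hs ω).1 hω
      exact (hs _).2 ⟨σ * τ, rfl⟩
    · intro ω hω
      obtain ⟨σ, rfl⟩ := (hs ω).1 hω
      exact (hs _).2 ⟨σ * τ⁻¹, rfl⟩
    · intro ω _; funext i; simp
    · intro ω _; funext i; simp
    · intro ω _; rfl
  have h2 : ∀ ω ∈ s, ∑ τ : Perm (Fin N), F (ω ∘ τ) = ∑ σ : Perm (Fin N), F (y ∘ σ) := by
    intro ω hω
    obtain ⟨σ, rfl⟩ := (hs ω).1 hω
    exact Equiv.sum_comp (Equiv.mulLeft σ) fun τ : Perm (Fin N) => F (y ∘ τ)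
  calc (Fintype.card (Perm (Fin N)) : ℝ) * ∑ ω ∈ s, F ω
      = ∑ τ : Perm (Fin N), ∑ ω ∈ s, F (ω ∘ τ) := by simp [h1]
    _ = ∑ ω ∈ s, ∑ τ : Perm (Fin N), F (ω ∘ τ) := sum_comm
    _ = ∑ ω ∈ s, ∑ σ : Perm (Fin N), F (y ∘ σ) := sum_congr rfl h2
    _ = _ := by simp

open Classical in
theorem mem_multislice_iff {L : ℕ} {κ : Fin L → ℕ} {x : Fin L → ℝ}
    {y : Fin (∑ ℓ, κ ℓ) → ℝ} (hy : y ∈ multislice κ x) (ω : Fin (∑ ℓ, κ ℓ) → ℝ) :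
    ω ∈ multislice κ x ↔ ∃ σ : Perm (Fin (∑ ℓ, κ ℓ)), y ∘ σ = ω := by
  have hcard : ∀ v : Fin (∑ ℓ, κ ℓ) → ℝ, ∀ ℓ,
      (∑ i, if v i = x ℓ then 1 else 0) = #{i | v i = x ℓ} := fun v ℓ => by
    rw [card_filter]
  constructor
  · intro hω
    refine exists_comp_perm_eq y ω fun c => ?_
    by_cases hc : c ∈ Set.range x
    · obtain ⟨ℓ, rfl⟩ := hc
      rw [← hcard, ← hcard]
      convert (hω.2 ℓ).trans (hy.2 ℓ).symm
    · rw [filter_false_of_mem, filter_false_of_mem]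
      · rintro i - rfl; exact hc (hy.1 i)
      · rintro i - rfl; exact hc (hω.1 i)
  · rintro ⟨σ, rfl⟩
    refine ⟨fun i => hy.1 (σ i), fun ℓ => ?_⟩
    rw [← hy.2 ℓ]
    exact Equiv.sum_comp σ fun i => if y i = x ℓ then 1 else 0

/-- The uniform law on the multislice is the image of the uniform law on permutations. -/
theorem integral_uniformMultislice {L : ℕ} {κ : Fin L → ℕ} {x : Fin L → ℝ}
    {y : Fin (∑ ℓ, κ ℓ) → ℝ} (hy : y ∈ multislice κ x) (F : (Fin (∑ ℓ, κ ℓ) → ℝ) → ℝ) :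
    ∫ ω, F ω ∂(uniformMultislice κ x) =
      (Fintype.card (Perm (Fin (∑ ℓ, κ ℓ))) : ℝ)⁻¹ *
        ∑ σ : Perm (Fin (∑ ℓ, κ ℓ)), F (y ∘ σ) := by
  have hfin : (multislice κ x).Finite := by
    refine (Set.finite_range fun σ : Perm (Fin (∑ ℓ, κ ℓ)) => y ∘ σ).subset fun ω hω => ?_
    exact (mem_multislice_iff hy ω).1 hω
  have h := card_mul_sum_orbit hfin.toFinset y
    (fun ω => by rw [hfin.mem_toFinset, mem_multislice_iff hy]) F
  have hs : ((hfin.toFinset.card : ℕ) : ℝ) ≠ 0 := by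
    exact_mod_cast (card_pos.2 ⟨y, hfin.mem_toFinset.2 hy⟩).ne'
  have hC : ((Fintype.card (Perm (Fin (∑ ℓ, κ ℓ))) : ℕ) : ℝ) ≠ 0 := by
    exact_mod_cast Fintype.card_ne_zero
  rw [uniformMultislice, ← hfin.coe_toFinset, integral_uniformOn_finset,
    inv_mul_eq_iff_eq_mul₀ hs, ← mul_assoc, mul_comm _ (_⁻¹), mul_assoc, ← h, ← mul_assoc,
    inv_mul_cancel₀ hC, one_mul]

end Multislice

end

/-! ### Conclusion -/

theorem proposition1p5 {L : ℕ} (hL : 2 ≤ L) (κ : Fin L → ℕ) (hκ : ∀ ℓ, 1 ≤ κ ℓ)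
    (x : Fin L → ℝ) (hx : Function.Injective x)
    (A : Set (Fin (∑ ℓ, κ ℓ) → ℝ)) (hA : A ⊆ Multislice.multislice κ x) :
    (Multislice.uniformMultislice κ x).real A *
        ∫ ω, Real.exp ((Multislice.convexDist ω A) ^ 2 / 144)
          ∂(Multislice.uniformMultislice κ x) ≤ 1 := by
  open Multislice in
  rcases A.eq_empty_or_nonempty with rfl | hne
  · simp
  obtain ⟨y, hyA⟩ := hne
  have hy := hA hyA
  have hne : A.Nonempty := ⟨y, hyA⟩
  have hAfin : A.Finite := by
    refine (Set.finite_range fun σ : Equiv.Perm (Fin (∑ ℓ, κ ℓ)) => y ∘ σ).subset fun ω hω => ?_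
    exact (mem_multislice_iff hy ω).1 (hA hω)
  have hP : (uniformMultislice κ x).real A =
      ∫ ω, A.indicator 1 ω ∂(uniformMultislice κ x) :=
    (integral_indicator_one hAfin.measurableSet).symm
  have key := sum_exp_mul_sum_exp_le
    (fun σ : Equiv.Perm (Fin (∑ ℓ, κ ℓ)) => convexDist (y ∘ σ) A ^ 2) (fun σ => sq_nonneg _)
    (fun σ i j => sq_convexDist_sub_le hne (y ∘ σ) i j)
    (fun σ => sum_sq_convexDist_sub_le hne (y ∘ σ))
  rw [hP, integral_uniformMultislice hy, integral_uniformMultislice hy]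
  set C : ℝ := ((Fintype.card (Equiv.Perm (Fin (∑ ℓ, κ ℓ))) : ℕ) : ℝ) with hCdef
  have hC : 0 < C := Nat.cast_pos.2 Fintype.card_pos
  -- The indicator of A is at most exp(-g/80), because g = 0 on A.
  have hle : ∑ σ : Equiv.Perm (Fin (∑ ℓ, κ ℓ)), A.indicator (1 : (Fin (∑ ℓ, κ ℓ) → ℝ) → ℝ) (y ∘ σ) ≤
      ∑ σ : Equiv.Perm (Fin (∑ ℓ, κ ℓ)), Real.exp (-(convexDist (y ∘ σ) A ^ 2 / 80)) := by
    refine Finset.sum_le_sum fun σ _ => ?_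
    by_cases hσ : y ∘ σ ∈ A
    · simp [hσ, convexDist_eq_zero_of_mem hσ]
    · simp only [Set.indicator_of_notMem hσ]
      exact (Real.exp_pos _).le
  have hpos : 0 ≤ ∑ σ : Equiv.Perm (Fin (∑ ℓ, κ ℓ)),
      Real.exp (convexDist (y ∘ σ) A ^ 2 / 144) :=
    Finset.sum_nonneg fun σ _ => (Real.exp_pos _).le
  have h := (mul_le_mul_of_nonneg_left hle hpos).trans key
  rw [mul_mul_mul_comm, ← mul_inv, ← sq, inv_mul_le_iff₀ (by positivity), mul_one, mul_comm]
  exact h
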